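/- **Unconditional stability of the incremental pressure projection scheme.** Let $\Omega\subset\mathbb R^3$ be a bounded domain (nonempty, open, connected) with $H^2$-regularity for the homogeneous Neumann problem: there is $c_\Omega$ such that every weak solution $\varphi\in H^1(\Omega)$ of $-\Delta\varphi=g$ in $\Omega$, $\partial_n\varphi=0$ on $\partial\Omega$ with $g\in L^2(\Omega)$ satisfies $\varphi\in H^2(\Omega)$ and $|D^2\varphi|^2\le c_\Omega|g|^2$. Here $|\cdot|$ is the $L^2(\Omega)$-norm, $\|\mathbf v\|:=|\nabla\mathbf v|$, and $$\mathbf H=\{\mathbf v\in L^2(\Omega)^3:\ \nabla\cdot\mathbf v=0\ \text{in }\Omega,\ \mathbf v\cdot\mathbf n=0\ \text{on }\partial\Omega\},$$ where the two conditions mean $\int_\Omega\mathbf v\cdot\nabla\varphi=0$ for all $\varphi\in C_c^\infty(\Omega)$ and $\int_\Omega\mathbf v\cdot\nabla q=0$ for all $q\in H^1(\Omega)$, respectively. Let $T>0$, $\mathbf u_0\in\mathbf H$, $C_0\in\mathbb R$, and $\mathbf f\in L^2(0,T;\mathbf H^{-1}(\Omega))$, where $\mathbf H^{-1}(\Omega)$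 is the dual of $H^1_0(\Omega)^3$. For an integer $M\ge1$ put $k=T/M$ and $t_m=mk$, and let the discrete forcing $\mathbf f^m\in\mathbf H^{-1}(\Omega)$, $1\le m\le M$, be given by one of the following two rules, the same for all $M$: * $\mathbf f^m=\mathbf f(t_m)$ for a pointwise defined representative $\mathbf f$ for which $\sup_{M\ge1}\frac TM\sum_{m=1}^M\|\mathbf f(mT/M)\|_{\mathbf H^{-1}}^2<\infty$ (for example $\mathbf f\in C([0,T];\mathbf H^{-1}(\Omega))$); or * $\mathbf f^m=\frac1k\int_{t_{m-1}}^{t_m}\mathbf f(t)\,dt$. Let $C(\mathbf a,\mathbf v)=(\mathbf a\cdot\nabla)\mathbf v+\frac12(\nabla\cdot\mathbf a)\mathbf v$. Given $p^0\in H^1(\Omega)$ (which may depend on $k$) and $\widetilde{\mathbf u}^0=\mathbf u^0=\mathbf u_0$, consider iterates $\widetilde{\mathbf u}^{m+1}\in H^1_0(\Omega)^3$, $\mathbf u^{m+1}\in\mathbf H$, $p^{m+1}\in H^1(\Omega)$, $m=0,\dots,M-1$, with (viscosity $1$) $$\frac1k(\widetilde{\mathbf u}^{m+1}-\mathbf u^m)+C(\widetilde{\mathbf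 u}^m,\widetilde{\mathbf u}^{m+1})-\Delta\widetilde{\mathbf u}^{m+1}+\nabla p^m=\mathbf f^{m+1}\quad\text{in the sense of distributions in }\Omega,$$ $$\frac1k(\mathbf u^{m+1}-\widetilde{\mathbf u}^{m+1})+\nabla(p^{m+1}-p^m)=0\quad\text{in }\Omega .$$ Then there is a constant $C>0$ depending only on $C_0$, $\mathbf u_0$, $\mathbf f$ (together with $T$ and the rule for $\mathbf f^m$) and $\Omega$, and not on $k$, such that for every $M\ge1$, every $p^0$ with $k|\nabla p^0|\le C_0$ and all such iterates, $$|\widetilde{\mathbf u}^{r+1}|^2+|\mathbf u^{r+1}|^2+|k\nabla p^{r+1}|^2\le C\qquad(r=0,\dots,M-1),$$ and $\mathbf u^{m+1}\in H^1(\Omega)^3$ for $m=0,\dots,M-1$, with $$k\sum_{m=0}^{M-1}\left(\|\widetilde{\mathbf u}^{m+1}\|^2+\|\mathbf u^{m+1}\|^2\right)\le C .$$ -/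

import Mathlib

open MeasureTheory Filter
open scoped ContDiff

noncomputable section

namespace ProjectionScheme

/-- The space `ℝ³`. -/
abbrev E3 : Type := EuclideanSpace ℝ (Fin 3)

/-- `L²(Ω)`. -/
abbrev L2 (Ω : Set E3) : Type := Lp ℝ 2 (volume.restrict Ω)

/-- `L²(Ω)³`, with the Hilbert norm `|v|² = ∑ i, |v i|²`. -/
abbrev L2V (Ω : Set E3) : Type := PiLp 2 (fun _ : Fin 3 => L2 Ω)

/-- Pairs `(q, g)` of a scalar function and a vector field, a candidate for its gradient. The norm
is `(|q|² + |g|²)^(1/2)`, which is the `H¹` norm when `g = ∇q`. -/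
abbrev Jet (Ω : Set E3) : Type := WithLp 2 (L2 Ω × L2V Ω)

/-- `φ ∈ C_c^∞(Ω)`. -/
def IsTestFunction (Ω : Set E3) (φ : E3 → ℝ) : Prop :=
  ContDiff ℝ ∞ φ ∧ HasCompactSupport φ ∧ tsupport φ ⊆ Ω

/-- The classical partial derivative `∂φ/∂x_j`. -/
def partialDeriv (j : Fin 3) (φ : E3 → ℝ) (x : E3) : ℝ :=
  fderiv ℝ φ x (EuclideanSpace.single j 1)

/-- The pairs `(φ, ∇φ)` with `φ ∈ C_c^∞(Ω)`. -/
def testSpace (Ω : Set E3) : Submodule ℝ (Jet Ω) where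
  carrier := {z | ∃ φ : E3 → ℝ, IsTestFunction Ω φ ∧
    z.fst =ᵐ[volume.restrict Ω] φ ∧ ∀ j, z.snd j =ᵐ[volume.restrict Ω] partialDeriv j φ}
  zero_mem' := by
    refine ⟨fun _ => 0, ⟨contDiff_const, HasCompactSupport.zero, ?_⟩, ?_, fun j => ?_⟩
    · have h : tsupport (fun _ : E3 => (0 : ℝ)) = ∅ := tsupport_eq_empty_iff.2 rfl
      rw [h]; exact Set.empty_subset _
    · exact Lp.coeFn_zero _ _ _
    · filter_upwards [Lp.coeFn_zero ℝ 2 (volume.restrict Ω)] with x hx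
      have h0 : ((0 : Jet Ω).snd j : L2 Ω) = 0 := rfl
      rw [h0, hx]
      simp [partialDeriv]
  add_mem' := by
    rintro a b ⟨φ, ⟨h1, h2, h3⟩, h4, h5⟩ ⟨ψ, ⟨k1, k2, k3⟩, k4, k5⟩
    refine ⟨φ + ψ, ⟨h1.add k1, h2.add k2,
      (tsupport_add φ ψ).trans (Set.union_subset h3 k3)⟩, ?_, fun j => ?_⟩
    · filter_upwards [Lp.coeFn_add a.fst b.fst, h4, k4] with x hx hx1 hx2
      have h0 : (a + b).fst = a.fst + b.fst := rfl
      rw [h0, hx]; simp [hx1, hx2]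
    · filter_upwards [Lp.coeFn_add (a.snd j) (b.snd j), h5 j, k5 j] with x hx hx1 hx2
      have h0 : (a + b).snd j = a.snd j + b.snd j := rfl
      rw [h0, hx, Pi.add_apply, hx1, hx2]
      unfold partialDeriv
      rw [fderiv_add (h1.differentiable (by simp) x) (k1.differentiable (by simp) x)]
      rfl
  smul_mem' := by
    rintro c a ⟨φ, ⟨h1, h2, h3⟩, h4, h5⟩
    refine ⟨c • φ, ⟨h1.const_smul c, h2.smul_left (f := fun _ => c),
      (tsupport_smul_subset_right (fun _ => c) φ).trans h3⟩, ?_, fun j => ?_⟩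
    · filter_upwards [Lp.coeFn_smul c a.fst, h4] with x hx hx1
      have h0 : (c • a).fst = c • a.fst := rfl
      rw [h0, hx]; simp [hx1]
    · filter_upwards [Lp.coeFn_smul c (a.snd j), h5 j] with x hx hx1
      have h0 : (c • a).snd j = c • a.snd j := rfl
      rw [h0, hx, Pi.smul_apply, hx1]
      unfold partialDeriv
      rw [fderiv_const_smul (h1.differentiable (by simp) x)]
      rfl

/-- `H¹(Ω)`: the pairs `(q, g)` such that `g` is the weak gradient of `q`, that is
`∫ q ∂_jφ = - ∫ g_j φ` for all `φ ∈ C_c^∞(Ω)` and all `j`. -/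
def H1 (Ω : Set E3) : Submodule ℝ (Jet Ω) where
  carrier := {z | ∀ ζ ∈ testSpace Ω, ∀ j,
    inner ℝ z.fst (ζ.snd j) = - inner ℝ (z.snd j) ζ.fst}
  zero_mem' := by
    intro ζ _ j
    have h1 : (0 : Jet Ω).fst = 0 := rfl
    have h2 : (0 : Jet Ω).snd j = 0 := rfl
    rw [h1, h2, inner_zero_left, inner_zero_left, neg_zero]
  add_mem' := by
    intro a b ha hb ζ hζ j
    have h1 : (a + b).fst = a.fst + b.fst := rfl
    have h2 : (a + b).snd j = a.snd j + b.snd j := rfl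
    rw [h1, h2, inner_add_left, inner_add_left, ha ζ hζ j, hb ζ hζ j]
    ring
  smul_mem' := by
    intro c a ha ζ hζ j
    have h1 : (c • a).fst = c • a.fst := rfl
    have h2 : (c • a).snd j = c • a.snd j := rfl
    rw [h1, h2, real_inner_smul_left, real_inner_smul_left, ha ζ hζ j]
    ring

/-- `H¹₀(Ω)`: the closure of `C_c^∞(Ω)` for the `H¹` norm. -/
def H01 (Ω : Set E3) : Submodule ℝ (Jet Ω) := (testSpace Ω).topologicalClosure

/-- `H¹₀(Ω)³`. -/
abbrev H01V (Ω : Set E3) : Type := PiLp 2 (fun _ : Fin 3 => H01 Ω)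

instance instNormedSpaceH01V (Ω : Set E3) : NormedSpace ℝ (H01V Ω) :=
  PiLp.normedSpace 2 ℝ (fun _ : Fin 3 => H01 Ω)

/-- `H⁻¹(Ω)³`, the dual space of `H¹₀(Ω)³`. -/
abbrev Hm1V (Ω : Set E3) : Type := StrongDual ℝ (H01V Ω)

/-- The gradient of an element of `H¹(Ω)`. -/
def gradH1 {Ω : Set E3} (q : H1 Ω) : L2V Ω := (q : Jet Ω).snd

/-- An element of `H¹(Ω)` seen in `L²(Ω)`. -/
def valH1 {Ω : Set E3} (q : H1 Ω) : L2 Ω := (q : Jet Ω).fst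

/-- An element of `H¹₀(Ω)³` seen in `L²(Ω)³`. -/
def valV {Ω : Set E3} (v : H01V Ω) : L2V Ω := WithLp.toLp 2 fun i => (v i : Jet Ω).fst

/-- `gradV v i j` is the weak derivative `∂v_i/∂x_j` of a field `v ∈ H¹₀(Ω)³`. -/
def gradV {Ω : Set E3} (v : H01V Ω) (i : Fin 3) : L2V Ω := (v i : Jet Ω).snd

/-- `d` is the weak divergence of `v`: `∫ v · ∇φ = - ∫ d φ` for all `φ ∈ C_c^∞(Ω)`. -/
def HasWeakDiv {Ω : Set E3} (v : L2V Ω) (d : L2 Ω) : Prop :=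
  ∀ ζ ∈ testSpace Ω, inner ℝ v ζ.snd = - inner ℝ d ζ.fst

/-- The space `H = {v ∈ L²(Ω)³ : ∇·v = 0 in Ω, v·n = 0 on ∂Ω}`. The normal trace of a
divergence-free `v` is the functional `q ↦ ∫ v · ∇q + ∫ (∇·v) q = ∫ v · ∇q` on `H¹(Ω)`. -/
def solenoidal (Ω : Set E3) : Set (L2V Ω) :=
  {v | HasWeakDiv v 0 ∧ ∀ q : H1 Ω, inner ℝ v (gradH1 q) = 0}

/-- The trilinear form `c(a, v, w) = ∫ ((a·∇)v)·w + ½ (∇·a) v·w`, where `d = ∇·a`. -/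
def convection {Ω : Set E3} (a : L2V Ω) (d : L2 Ω) (v w : H01V Ω) : ℝ :=
  ∫ x in Ω, ∑ i, ((∑ j, a j x * gradV v i j x) + 1 / 2 * d x * valV v i x) * valV w i x

/-- `H²`-regularity of the homogeneous Neumann problem for the Poisson equation in `Ω`:
a weak solution `φ ∈ H¹(Ω)` of `-Δφ = g`, `∂φ/∂n = 0` with `g ∈ L²(Ω)` lies in `H²(Ω)`, and
`|D²φ| ≤ C |g|`. -/
def NeumannH2Regular (Ω : Set E3) : Prop :=
  ∃ C : ℝ, ∀ (g : L2 Ω) (φ : H1 Ω),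
    (∀ q : H1 Ω, inner ℝ (gradH1 φ) (gradH1 q) = inner ℝ g (valH1 q)) →
    ∃ D : Fin 3 → H1 Ω, (∀ j, valH1 (D j) = gradH1 φ j) ∧
      ∑ j, ‖gradH1 (D j)‖ ^ 2 ≤ C * ‖g‖ ^ 2

/-- The point values `f^m = f(t_m)`, where `t_m = m T / M`. -/
def pointValues {Ω : Set E3} (T : ℝ) (f : ℝ → Hm1V Ω) (M m : ℕ) : Hm1V Ω :=
  f (m * (T / M))

/-- The means `f^m = k⁻¹ ∫_{t_{m-1}}^{t_m} f(t) dt`, where `k = T / M` and `t_m = m k`. -/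
def cellMeans {Ω : Set E3} (T : ℝ) (f : ℝ → Hm1V Ω) (M m : ℕ) : Hm1V Ω :=
  (T / M)⁻¹ • ∫ t in (((m : ℝ) - 1) * (T / M))..(m * (T / M)), f t

/-- `F M m` is the forcing `f^m` on the partition of `[0, T]` in `M` steps. Either it is the value
`f(t_m)`, the values having discrete `L²(0,T;H⁻¹)` norms that stay bounded as the partition is
refined; or it is the mean of `f` over `(t_{m-1}, t_m)`. -/
def IsForcing {Ω : Set E3} (T : ℝ) (f : ℝ → Hm1V Ω) (F : ℕ → ℕ → Hm1V Ω) : Prop :=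
  (F = pointValues T f ∧
    ∃ B : ℝ, ∀ M : ℕ, 1 ≤ M → T / M * ∑ m ∈ Finset.Icc 1 M, ‖pointValues T f M m‖ ^ 2 ≤ B) ∨
  F = cellMeans T f

/-- `(ũ^m)`, `(u^m)`, `(p^m)`, `0 ≤ m ≤ M`, are iterates of the incremental pressure projection
scheme with step `k`, initial velocity `u₀` and forcing `(f^m)`. For `m ≥ 1`, `ũ^m ∈ H¹₀(Ω)³`
is `V m`, and `ut m` is the same field seen in `L²(Ω)³`. -/
structure IsIterates {Ω : Set E3} (k : ℝ) (M : ℕ) (u₀ : L2V Ω) (f : ℕ → Hm1V Ω)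
    (ut : ℕ → L2V Ω) (V : ℕ → H01V Ω) (u : ℕ → L2V Ω) (p : ℕ → H1 Ω) : Prop where
  ut_zero : ut 0 = u₀
  u_zero : u 0 = u₀
  ut_eq : ∀ m < M, ut (m + 1) = valV (V (m + 1))
  /-- `k⁻¹(ũ^{m+1} - u^m) + C(ũ^m, ũ^{m+1}) - Δũ^{m+1} + ∇p^m = f^{m+1}` in the sense of
  distributions in `Ω`. -/
  step_one : ∀ m < M, ∃ d : L2 Ω, HasWeakDiv (ut m) d ∧
    ∀ w : H01V Ω, (∀ i, (w i : Jet Ω) ∈ testSpace Ω) →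
      1 / k * inner ℝ (ut (m + 1) - u m) (valV w)
        + convection (ut m) d (V (m + 1)) w
        + ∑ i, inner ℝ (gradV (V (m + 1)) i) (gradV w i)
        + inner ℝ (gradH1 (p m)) (valV w) = f (m + 1) w
  /-- `k⁻¹(u^{m+1} - ũ^{m+1}) + ∇(p^{m+1} - p^m) = 0`. -/
  step_two : ∀ m < M,
    (1 / k) • (u (m + 1) - ut (m + 1)) + gradH1 (p (m + 1) - p m) = 0
  /-- `∇·u^{m+1} = 0` in `Ω` and `u^{m+1}·n = 0` on `∂Ω`. -/
  mem_solenoidal : ∀ m < M, u (m + 1) ∈ solenoidal Ω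

end ProjectionScheme

end

/-!
The energy identity of the scheme is classical: testing the momentum equation with `ũ^{m+1}`, and
taking the squared norm of `u^{m+1} + k∇p^{m+1} = ũ^{m+1} + k∇p^m`, whose left-hand side is an
orthogonal sum because `u^{m+1}` is solenoidal, the terms `(∇p^m, ũ^{m+1})` cancel. Since the
convection form drops out, `|u^m|² + |k∇p^m|²` grows in one step by at most a multiple of
`k‖f^{m+1}‖²`, after the Poincaré inequality has absorbed the test function
(`IsIterates.energy_step`). The sums `k ∑ ‖f^m‖²` are bounded uniformly in `k`
(`IsForcing.exists_bound`). The bound on `ũ^{m+1} = u^{m+1} + k∇(p^{m+1} - p^m)` follows. Finally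
`k(p^{m+1} - p^m)` solves a homogeneous Neumann problem with right-hand side `-∇·ũ^{m+1}`, so that
`H²`-regularity gives `u^{m+1} ∈ H¹(Ω)³` with `‖u^{m+1}‖ ≤ C ‖ũ^{m+1}‖`
(`exists_H1_of_projection`).

The delicate point is that the momentum equation holds against test functions only, whereas the
energy identity needs `ũ^{m+1} ∈ H¹₀(Ω)³`. In the first step the convecting field `ũ^0 = u₀` is
merely square integrable, and the convection form need not be continuous on `H¹₀(Ω)`. By the
equation it nevertheless agrees on test functions with a continuous functional `ℓ`, and
`functional_self_eq_zero` shows `ℓ v = 0` for any such `ℓ`. There, a component `v` is approximated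
by test functions `φ`, truncated to `sin (sφ) / s`. The truncation is a bounded test function, so
that replacing `v` by `φ` in the form costs `|v - φ|_{H¹} / s`; for `φ` itself
`(sin (sφ) / s) ∇φ = ∇((1 - cos (sφ)) / s²)` is a gradient, and the definition of the weak
divergence leaves a zero-order term of size `s |∇·a| |φ|³_{L⁶}`, which the Sobolev inequality
controls. Letting `φ → v` and then `s → 0` gives the claim, since the truncations then converge to
`v` in `H¹` (`norm_jet_sin_sub_snd_le`).
-/

namespace ProjectionScheme

variable {Ω : Set E3} {φ ψ : E3 → ℝ}

/-! ### Test functions and their jets -/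

namespace IsTestFunction

lemma continuous (h : IsTestFunction Ω φ) : Continuous φ := h.1.continuous

lemma differentiable (h : IsTestFunction Ω φ) : Differentiable ℝ φ := h.1.differentiable (by simp)

lemma partialDeriv (h : IsTestFunction Ω φ) (j : Fin 3) :
    IsTestFunction Ω (partialDeriv j φ) := by
  refine ⟨?_, h.2.1.fderiv_apply ℝ _, (tsupport_fderiv_apply_subset ℝ _).trans h.2.2⟩
  exact (h.1.fderiv_right (m := ∞) (by simp)).clm_apply contDiff_const

lemma comp (h : IsTestFunction Ω φ) {g : ℝ → ℝ} (hg : ContDiff ℝ ∞ g) (h0 : g 0 = 0) :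
    IsTestFunction Ω (g ∘ φ) :=
  ⟨hg.comp h.1, h.2.1.comp_left h0, (tsupport_comp_subset h0 φ).trans h.2.2⟩

lemma mul (h : IsTestFunction Ω φ) (hψ : IsTestFunction Ω ψ) : IsTestFunction Ω (φ * ψ) :=
  ⟨h.1.mul hψ.1, h.2.1.mul_right, (tsupport_mul_subset_left).trans h.2.2⟩

lemma memLp (h : IsTestFunction Ω φ) (μ : Measure E3) [IsFiniteMeasureOnCompacts μ]
    (p : ENNReal) : MemLp φ p μ :=
  h.continuous.memLp_of_hasCompactSupport h.2.1

lemma support_subset (h : IsTestFunction Ω φ) : Function.support φ ⊆ Ω :=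
  (subset_tsupport φ).trans h.2.2

lemma exists_bound (h : IsTestFunction Ω φ) : ∃ K, 0 ≤ K ∧ ∀ x, |φ x| ≤ K := by
  obtain ⟨K, hK⟩ := h.2.1.exists_bound_of_continuous h.continuous
  exact ⟨K, (norm_nonneg _).trans (hK 0), hK⟩

end IsTestFunction

lemma partialDeriv_comp (hφ : IsTestFunction Ω φ) {g : ℝ → ℝ} (hg : ContDiff ℝ ∞ g)
    (j : Fin 3) (x : E3) :
    partialDeriv j (g ∘ φ) x = deriv g (φ x) * partialDeriv j φ x := by
  unfold partialDeriv
  rw [fderiv_comp x (hg.differentiable (by simp) _) (hφ.differentiable x)]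
  simp [mul_comm]

/-- The pair `(φ, ∇φ)` of a test function. -/
noncomputable def jet (hφ : IsTestFunction Ω φ) : Jet Ω :=
  WithLp.toLp 2 ((hφ.memLp _ 2).toLp φ,
    WithLp.toLp 2 fun j => ((hφ.partialDeriv j).memLp _ 2).toLp (partialDeriv j φ))

lemma jet_fst (hφ : IsTestFunction Ω φ) :
    (jet hφ).fst = (hφ.memLp (volume.restrict Ω) 2).toLp φ := rfl

lemma jet_snd (hφ : IsTestFunction Ω φ) (j : Fin 3) : (jet hφ).snd j =
    ((hφ.partialDeriv j).memLp (volume.restrict Ω) 2).toLp (partialDeriv j φ) := rfl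

lemma coeFn_jet_fst (hφ : IsTestFunction Ω φ) : (jet hφ).fst =ᵐ[volume.restrict Ω] φ :=
  MemLp.coeFn_toLp (hφ.memLp _ 2)

lemma coeFn_jet_snd (hφ : IsTestFunction Ω φ) (j : Fin 3) :
    (jet hφ).snd j =ᵐ[volume.restrict Ω] partialDeriv j φ :=
  MemLp.coeFn_toLp ((hφ.partialDeriv j).memLp _ 2)

lemma jet_mem_testSpace (hφ : IsTestFunction Ω φ) : jet hφ ∈ testSpace Ω :=
  ⟨φ, hφ, coeFn_jet_fst hφ, coeFn_jet_snd hφ⟩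

lemma exists_eq_jet {z : Jet Ω} (hz : z ∈ testSpace Ω) :
    ∃ (φ : E3 → ℝ) (hφ : IsTestFunction Ω φ), z = jet hφ := by
  obtain ⟨φ, hφ, h1, h2⟩ := hz
  refine ⟨φ, hφ, ?_⟩
  have e1 : z.fst = (jet hφ).fst := Lp.ext (h1.trans (coeFn_jet_fst hφ).symm)
  have e2 : z.snd = (jet hφ).snd := by
    ext1 j
    exact Lp.ext ((h2 j).trans (coeFn_jet_snd hφ j).symm)
  exact WithLp.ofLp_injective 2 (Prod.ext e1 e2)

lemma testSpace_le_H01 : testSpace Ω ≤ H01 Ω := Submodule.le_topologicalClosure _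

lemma exists_jet_norm_sub_lt {z : Jet Ω} (hz : z ∈ H01 Ω) {δ : ℝ} (hδ : 0 < δ) :
    ∃ (φ : E3 → ℝ) (hφ : IsTestFunction Ω φ), ‖z - jet hφ‖ < δ := by
  obtain ⟨y, hy, hyz⟩ := Metric.mem_closure_iff.1 hz δ hδ
  obtain ⟨φ, hφ, rfl⟩ := exists_eq_jet hy
  exact ⟨φ, hφ, by rwa [← dist_eq_norm]⟩

/-! ### Norms of jets -/

lemma norm_fst_le (z : Jet Ω) : ‖z.fst‖ ≤ ‖z‖ := WithLp.norm_fst_le _ z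

lemma norm_snd_le (z : Jet Ω) : ‖z.snd‖ ≤ ‖z‖ := WithLp.norm_snd_le _ z

lemma norm_snd_apply_le (z : Jet Ω) (j : Fin 3) : ‖z.snd j‖ ≤ ‖z‖ :=
  (PiLp.norm_apply_le z.snd j).trans (norm_snd_le z)

lemma norm_jet_le (z : Jet Ω) : ‖z‖ ≤ ‖z.fst‖ + ‖z.snd‖ := by
  rw [← abs_norm z, ← abs_of_nonneg (add_nonneg (norm_nonneg z.fst) (norm_nonneg z.snd))]
  apply sq_le_sq.1
  rw [WithLp.prod_norm_sq_eq_of_L2]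
  nlinarith [norm_nonneg z.fst, norm_nonneg z.snd]

lemma norm_L2V_le_sum (g : L2V Ω) : ‖g‖ ≤ ∑ j, ‖g j‖ := by
  rw [← abs_norm g, ← abs_of_nonneg (Finset.sum_nonneg fun j _ => norm_nonneg (g j))]
  apply sq_le_sq.1
  rw [PiLp.norm_sq_eq_of_L2]
  exact Finset.sum_sq_le_sq_sum_of_nonneg fun _ _ => norm_nonneg _

/-! ### Integration by parts -/

lemma inner_eq_integral (f g : L2 Ω) : inner ℝ f g = ∫ x in Ω, f x * g x := by
  rw [L2.inner_def]
  simp [mul_comm]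

lemma testSpace_le_H1 : testSpace Ω ≤ H1 Ω := by
  intro z hz ζ hζ j
  obtain ⟨φ, hφ, rfl⟩ := exists_eq_jet hz
  obtain ⟨ψ, hψ, rfl⟩ := exists_eq_jet hζ
  have e1 : inner ℝ (jet hφ).fst ((jet hψ).snd j) = ∫ x in Ω, φ x * partialDeriv j ψ x := by
    rw [inner_eq_integral]
    apply integral_congr_ae
    filter_upwards [coeFn_jet_fst hφ, coeFn_jet_snd hψ j] with x h1 h2
    rw [h1, h2]
  have e2 : inner ℝ ((jet hφ).snd j) (jet hψ).fst = ∫ x in Ω, partialDeriv j φ x * ψ x := by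
    rw [inner_eq_integral]
    apply integral_congr_ae
    filter_upwards [coeFn_jet_fst hψ, coeFn_jet_snd hφ j] with x h1 h2
    rw [h1, h2]
  have aux {f g : E3 → ℝ} (hf : IsTestFunction Ω f) (hg : IsTestFunction Ω g) :
      Integrable (fun x => f x * g x) volume :=
    (hf.memLp volume 2).integrable_mul (hg.memLp volume 2)
  rw [e1, e2, setIntegral_eq_integral_of_forall_compl_eq_zero,
    setIntegral_eq_integral_of_forall_compl_eq_zero]
  · exact integral_mul_fderiv_eq_neg_fderiv_mul_of_integrable (aux (hφ.partialDeriv j) hψ)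
      (aux hφ (hψ.partialDeriv j)) (aux hφ hψ) (fun x _ => hφ.differentiable x)
      (fun x _ => hψ.differentiable x)
  · intro x hx
    rw [Function.notMem_support.1 fun h => hx (hψ.support_subset h), mul_zero]
  · intro x hx
    rw [Function.notMem_support.1 fun h => hx (hφ.support_subset h), zero_mul]

lemma continuous_fst : Continuous fun z : Jet Ω => z.fst := by fun_prop

lemma continuous_snd_apply (j : Fin 3) : Continuous fun z : Jet Ω => z.snd j := by fun_prop

/-- Green's formula for `q ∈ H¹(Ω)` and `z ∈ H¹₀(Ω)`. -/
lemma inner_fst_snd_of_mem_H01 {q z : Jet Ω} (hq : q ∈ H1 Ω) (hz : z ∈ H01 Ω) (j : Fin 3) :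
    inner ℝ q.fst (z.snd j) = - inner ℝ (q.snd j) z.fst := by
  have hc : IsClosed {z : Jet Ω | inner ℝ q.fst (z.snd j) = - inner ℝ (q.snd j) z.fst} :=
    isClosed_eq (continuous_const.inner (continuous_snd_apply j))
      (continuous_const.inner continuous_fst).neg
  exact closure_minimal (fun ζ hζ => hq ζ hζ j) hc hz

lemma H01_le_H1 : H01 Ω ≤ H1 Ω := by
  intro z hz ζ hζ j
  have h := inner_fst_snd_of_mem_H01 (testSpace_le_H1 hζ) hz j
  rw [real_inner_comm, real_inner_comm ζ.fst, h, neg_neg]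

/-! ### The inequalities of Poincaré and Sobolev -/

lemma norm_fderiv_le_sum (φ : E3 → ℝ) (x : E3) :
    ‖fderiv ℝ φ x‖ ≤ ∑ j, ‖partialDeriv j φ x‖ := by
  refine ContinuousLinearMap.opNorm_le_bound _ (Finset.sum_nonneg fun _ _ => norm_nonneg _) ?_
  intro y
  have hy : y = ∑ j, y j • EuclideanSpace.single j (1 : ℝ) := by
    ext i
    simp [Pi.single_apply]
  conv_lhs => rw [hy, map_sum]
  refine (norm_sum_le _ _).trans ?_
  rw [Finset.sum_mul]
  refine Finset.sum_le_sum fun j _ => ?_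
  rw [map_smul, norm_smul, mul_comm]
  exact mul_le_mul_of_nonneg_left (PiLp.norm_apply_le y j) (norm_nonneg _)

lemma eLpNorm_partialDeriv (hφ : IsTestFunction Ω φ) (j : Fin 3) :
    eLpNorm (partialDeriv j φ) 2 volume = ENNReal.ofReal ‖(jet hφ).snd j‖ := by
  rw [jet_snd, Lp.norm_toLp, ENNReal.ofReal_toReal ((hφ.partialDeriv j).memLp _ 2).2.ne,
    eLpNorm_restrict_eq_of_support_subset (hφ.partialDeriv j).support_subset]

lemma eLpNorm_fderiv_le (hφ : IsTestFunction Ω φ) :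
    eLpNorm (fderiv ℝ φ) 2 volume ≤ ENNReal.ofReal (3 * ‖(jet hφ).snd‖) := by
  have hm (j : Fin 3) : AEStronglyMeasurable (fun x => ‖partialDeriv j φ x‖) volume :=
    (hφ.partialDeriv j).continuous.norm.aestronglyMeasurable
  calc eLpNorm (fderiv ℝ φ) 2 volume
      ≤ eLpNorm (∑ j, fun x => ‖partialDeriv j φ x‖) 2 volume :=
        eLpNorm_mono_real fun x => by simpa using norm_fderiv_le_sum φ x
    _ ≤ ∑ j, eLpNorm (fun x => ‖partialDeriv j φ x‖) 2 volume :=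
        eLpNorm_sum_le (fun j _ => hm j) (by norm_num)
    _ = ∑ j, ENNReal.ofReal ‖(jet hφ).snd j‖ := by
        refine Finset.sum_congr rfl fun j _ => ?_
        rw [eLpNorm_norm, eLpNorm_partialDeriv hφ j]
    _ = ENNReal.ofReal (∑ j, ‖(jet hφ).snd j‖) :=
        (ENNReal.ofReal_sum_of_nonneg fun _ _ => norm_nonneg _).symm
    _ ≤ _ := by
        refine ENNReal.ofReal_le_ofReal ?_
        refine (Finset.sum_le_sum fun j _ => PiLp.norm_apply_le (jet hφ).snd j).trans ?_
        simp

lemma exists_poincare (hΩ : Bornology.IsBounded Ω) :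
    ∃ K, 0 ≤ K ∧ ∀ z ∈ H01 Ω, ‖z.fst‖ ≤ K * ‖z.snd‖ := by
  let K := eLpNormLESNormFDerivOfLeConst ℝ (volume : Measure E3) Ω 2 2
  refine ⟨K * 3, by positivity, fun z hz => ?_⟩
  have hc : IsClosed {z : Jet Ω | ‖z.fst‖ ≤ K * 3 * ‖z.snd‖} :=
    isClosed_le (by fun_prop) (by fun_prop)
  refine closure_minimal (fun ζ hζ => ?_) hc hz
  obtain ⟨φ, hφ, rfl⟩ := exists_eq_jet hζ
  have h := eLpNorm_le_eLpNorm_fderiv volume (p := 2) (hφ.1.of_le (by simp))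
    hφ.support_subset (by norm_num) (by simp; norm_num) hΩ
  have h2 := h.trans (mul_le_mul_right (eLpNorm_fderiv_le hφ) _)
  rw [Set.mem_ofPred_eq, jet_fst, Lp.norm_toLp]
  refine ENNReal.toReal_le_of_le_ofReal (by positivity) ?_
  rw [eLpNorm_restrict_eq_of_support_subset hφ.support_subset]
  refine h2.trans (le_of_eq ?_)
  rw [mul_assoc, ENNReal.ofReal_mul (p := (K : ℝ)) (by positivity),
    ENNReal.ofReal_coe_nnreal]

/-- The Sobolev inequality `|φ|_{L⁶} ≤ K |∇φ|`. -/
lemma exists_sobolev (Ω : Set E3) : ∃ K, 0 ≤ K ∧ ∀ (φ : E3 → ℝ) (hφ : IsTestFunction Ω φ),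
    (eLpNorm φ 6 (volume.restrict Ω)).toReal ≤ K * ‖(jet hφ).snd‖ := by
  let K := SNormLESNormFDerivOfEqConst ℝ (volume : Measure E3) (2 : NNReal)
  refine ⟨K * 3, by positivity, fun φ hφ => ?_⟩
  have h := eLpNorm_le_eLpNorm_fderiv_of_eq volume (p := 2) (p' := 6) (hφ.1.of_le (by simp))
    hφ.2.1 (by norm_num) (by simp) (by simp; norm_num)
  have h2 := h.trans (mul_le_mul_right (eLpNorm_fderiv_le hφ) _)
  refine ENNReal.toReal_le_of_le_ofReal (by positivity) ?_
  rw [eLpNorm_restrict_eq_of_support_subset hφ.support_subset]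
  refine h2.trans (le_of_eq ?_)
  rw [mul_assoc, ENNReal.ofReal_mul (p := (K : ℝ)) (by positivity),
    ENNReal.ofReal_coe_nnreal]

/-! ### Products in `L²` -/

lemma integrable_mul (f g : L2 Ω) : Integrable (fun x => f x * g x) (volume.restrict Ω) :=
  (Lp.memLp f).integrable_mul (Lp.memLp g)

lemma integrable_mul_mul (f g : L2 Ω) {b : E3 → ℝ} (hb : Continuous b) {K : ℝ}
    (hK : ∀ x, |b x| ≤ K) : Integrable (fun x => f x * g x * b x) (volume.restrict Ω) :=
  (integrable_mul f g).mul_bdd hb.aestronglyMeasurable (Eventually.of_forall hK)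

lemma abs_integral_mul_le (f : L2 Ω) {h : E3 → ℝ} (hh : MemLp h 2 (volume.restrict Ω)) :
    |∫ x in Ω, f x * h x| ≤ ‖f‖ * (eLpNorm h 2 (volume.restrict Ω)).toReal := by
  have e : ∫ x in Ω, f x * h x = inner ℝ f (hh.toLp h) := by
    rw [inner_eq_integral]
    apply integral_congr_ae
    filter_upwards [hh.coeFn_toLp] with x hx
    rw [hx]
  rw [e, ← Lp.norm_toLp h hh]
  exact abs_real_inner_le_norm _ _

lemma abs_integral_mul_mul_le (f g : L2 Ω) {b : E3 → ℝ} (hb : Continuous b) {K : ℝ}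
    (hK : ∀ x, |b x| ≤ K) : |∫ x in Ω, f x * g x * b x| ≤ K * (‖f‖ * ‖g‖) := by
  have hK0 : 0 ≤ K := (abs_nonneg _).trans (hK 0)
  have hle : ∀ᵐ x ∂volume.restrict Ω, ‖g x * b x‖ ≤ K * ‖g x‖ :=
    Eventually.of_forall fun x => by
      rw [norm_mul, mul_comm]
      exact mul_le_mul_of_nonneg_right (hK x) (norm_nonneg _)
  have hL : MemLp (fun x => g x * b x) 2 (volume.restrict Ω) :=
    (Lp.memLp g).of_le_mul ((Lp.memLp g).1.mul hb.aestronglyMeasurable) hle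
  have hN : (eLpNorm (fun x => g x * b x) 2 (volume.restrict Ω)).toReal ≤ K * ‖g‖ := by
    refine ENNReal.toReal_le_of_le_ofReal (by positivity) ?_
    refine (eLpNorm_le_mul_eLpNorm_of_ae_le_mul hle 2).trans (le_of_eq ?_)
    rw [ENNReal.ofReal_mul hK0, Lp.norm_def, ENNReal.ofReal_toReal (Lp.memLp g).2.ne]
  simp only [mul_assoc]
  refine (abs_integral_mul_le f hL).trans ?_
  calc ‖f‖ * _ ≤ ‖f‖ * (K * ‖g‖) := mul_le_mul_of_nonneg_left hN (norm_nonneg _)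
    _ = K * (‖f‖ * ‖g‖) := by ring

/-! ### The truncation -/

/-- The third-order bound behind the vanishing of the zero-order remainder of the truncation. -/
lemma abs_half_mul_sin_add_cos_sub_one_le (t : ℝ) :
    |1 / 2 * t * Real.sin t + Real.cos t - 1| ≤ 3 * |t| ^ 3 := by
  have h0 := abs_nonneg t
  rcases le_total |t| 1 with ht | ht
  · have hs := Real.sin_bound ht
    have hc := Real.cos_bound ht
    have e : 1 / 2 * t * Real.sin t + Real.cos t - 1
        = 1 / 2 * (t * (Real.sin t - (t - t ^ 3 / 6))) + (Real.cos t - (1 - t ^ 2 / 2))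
          - t ^ 4 / 12 := by ring
    have h1 : |t * (Real.sin t - (t - t ^ 3 / 6))| ≤ |t| ^ 3 := by
      rw [abs_mul]
      calc |t| * _ ≤ 1 * (|t| ^ 5 / 100) := mul_le_mul ht hs (abs_nonneg _) zero_le_one
        _ ≤ |t| ^ 5 := by have := pow_nonneg h0 5; linarith
        _ ≤ |t| ^ 3 := pow_le_pow_of_le_one h0 ht (by norm_num)
    have h2 : |t| ^ 4 ≤ |t| ^ 3 := pow_le_pow_of_le_one h0 ht (by norm_num)
    have h3 : t ^ 4 = |t| ^ 4 := by rw [← abs_pow, abs_of_nonneg (by positivity)]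
    have h4 := pow_nonneg h0 3
    rw [e, h3]
    rw [abs_le] at h1 hc ⊢
    have := pow_nonneg h0 4
    constructor <;> linarith [h1.1, h1.2, hc.1, hc.2]
  · have h1 : |t * Real.sin t| ≤ |t| := by
      rw [abs_mul]
      exact mul_le_of_le_one_right h0 (Real.abs_sin_le_one t)
    have h2 : |t| ≤ |t| ^ 3 := le_self_pow₀ ht (by norm_num)
    rw [abs_le] at h1 ⊢
    constructor <;> linarith [h1.1, h1.2, Real.cos_le_one t, Real.neg_one_le_cos t]

lemma abs_cos_sub_one_le (t : ℝ) : |Real.cos t - 1| ≤ |t| := by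
  rw [abs_sub_comm, abs_of_nonneg (by linarith [Real.cos_le_one t])]
  rcases le_total |t| 2 with ht | ht
  · nlinarith [Real.one_sub_sq_div_two_le_cos (x := t), sq_abs t, abs_nonneg t]
  · linarith [Real.neg_one_le_cos t]

lemma eLpNorm_abs_pow_three (φ : E3 → ℝ) (μ : Measure E3) :
    eLpNorm (fun x => |φ x| ^ 3) 2 μ = eLpNorm φ 6 μ ^ 3 := by
  have h := eLpNorm_norm_rpow (p := 2) (μ := μ) φ (q := 3) (by norm_num)
  have e : (2 : ENNReal) * ENNReal.ofReal 3 = 6 := by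
    rw [ENNReal.ofReal_ofNat]; norm_num
  rw [e] at h
  exact_mod_cast h

lemma contDiff_sin_mul_div (s : ℝ) : ContDiff ℝ ∞ fun y : ℝ => Real.sin (s * y) / s :=
  (Real.contDiff_sin.comp (contDiff_const.mul contDiff_id)).div_const s

lemma contDiff_one_sub_cos_mul_div (s : ℝ) :
    ContDiff ℝ ∞ fun y : ℝ => (1 - Real.cos (s * y)) / s ^ 2 :=
  (contDiff_const.sub (Real.contDiff_cos.comp (contDiff_const.mul contDiff_id))).div_const _

lemma deriv_sin_mul_div {s : ℝ} (hs : s ≠ 0) (y : ℝ) :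
    deriv (fun y : ℝ => Real.sin (s * y) / s) y = Real.cos (s * y) := by
  have h := (((hasDerivAt_id y).const_mul s).sin).div_const s
  simp only [id, mul_one] at h
  rw [h.deriv]
  field_simp

lemma deriv_one_sub_cos_mul_div {s : ℝ} (hs : s ≠ 0) (y : ℝ) :
    deriv (fun y : ℝ => (1 - Real.cos (s * y)) / s ^ 2) y = Real.sin (s * y) / s := by
  have h := ((((hasDerivAt_id y).const_mul s).cos).const_sub 1).div_const (s ^ 2)
  simp only [id, mul_one] at h
  rw [h.deriv]
  field_simp

lemma IsTestFunction.sin_mul_div (hφ : IsTestFunction Ω φ) (s : ℝ) :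
    IsTestFunction Ω ((fun y : ℝ => Real.sin (s * y) / s) ∘ φ) :=
  hφ.comp (contDiff_sin_mul_div s) (by simp)

lemma IsTestFunction.one_sub_cos_mul_div (hφ : IsTestFunction Ω φ) (s : ℝ) :
    IsTestFunction Ω ((fun y : ℝ => (1 - Real.cos (s * y)) / s ^ 2) ∘ φ) :=
  hφ.comp (contDiff_one_sub_cos_mul_div s) (by simp)

lemma abs_sin_mul_div_le {s : ℝ} (hs : 0 < s) (y : ℝ) : |Real.sin (s * y) / s| ≤ s⁻¹ := by
  rw [abs_div, abs_of_pos hs, div_eq_mul_inv]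
  exact mul_le_of_le_one_left (inv_nonneg.2 hs.le) (Real.abs_sin_le_one _)

/-! ### Skew-symmetry of the convection form -/

/-- The form `∫ (a·∇y + ½ d y) b` for a jet `y` and a bounded weight `b`. -/
noncomputable def advect (a : L2V Ω) (d : L2 Ω) (y : Jet Ω) (b : E3 → ℝ) : ℝ :=
  (∑ j, ∫ x in Ω, a j x * y.snd j x * b x) + 1 / 2 * ∫ x in Ω, d x * y.fst x * b x

lemma integral_mul_sub_mul (f g h : L2 Ω) {b : E3 → ℝ} (hb : Continuous b) {K : ℝ}
    (hK : ∀ x, |b x| ≤ K) : ∫ x in Ω, f x * (g - h) x * b x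
      = (∫ x in Ω, f x * g x * b x) - ∫ x in Ω, f x * h x * b x := by
  rw [← integral_sub (integrable_mul_mul f g hb hK) (integrable_mul_mul f h hb hK)]
  apply integral_congr_ae
  filter_upwards [Lp.coeFn_sub g h] with x hx
  rw [hx, Pi.sub_apply]
  ring

lemma advect_sub (a : L2V Ω) (d : L2 Ω) (y z : Jet Ω) {b : E3 → ℝ} (hb : Continuous b) {K : ℝ}
    (hK : ∀ x, |b x| ≤ K) : advect a d (y - z) b = advect a d y b - advect a d z b := by
  have e1 : (y - z).fst = y.fst - z.fst := rfl
  have e2 (j : Fin 3) : (y - z).snd j = y.snd j - z.snd j := rfl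
  simp only [advect, e1, e2, integral_mul_sub_mul _ _ _ hb hK, Finset.sum_sub_distrib]
  ring

lemma abs_advect_le (a : L2V Ω) (d : L2 Ω) (y : Jet Ω) {b : E3 → ℝ} (hb : Continuous b) {K : ℝ}
    (hK : ∀ x, |b x| ≤ K) : |advect a d y b| ≤ K * (((∑ j, ‖a j‖) + ‖d‖) * ‖y‖) := by
  have hK0 : 0 ≤ K := (abs_nonneg _).trans (hK 0)
  have h1 (j : Fin 3) : |∫ x in Ω, a j x * y.snd j x * b x| ≤ K * (‖a j‖ * ‖y‖) := by
    refine (abs_integral_mul_mul_le (a j) (y.snd j) hb hK).trans ?_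
    gcongr
    exact norm_snd_apply_le y j
  have h2 : |∫ x in Ω, d x * y.fst x * b x| ≤ K * (‖d‖ * ‖y‖) := by
    refine (abs_integral_mul_mul_le d y.fst hb hK).trans ?_
    gcongr
    exact norm_fst_le y
  have h3 : 0 ≤ K * (‖d‖ * ‖y‖) := by positivity
  calc |advect a d y b|
      ≤ (∑ j, |∫ x in Ω, a j x * y.snd j x * b x|) + 1 / 2 * |∫ x in Ω, d x * y.fst x * b x| := by
        refine (abs_add_le _ _).trans (add_le_add (Finset.abs_sum_le_sum_abs _ _) ?_)
        rw [abs_mul, abs_of_pos (by norm_num : (0 : ℝ) < 1 / 2)]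
    _ ≤ (∑ j, K * (‖a j‖ * ‖y‖)) + K * (‖d‖ * ‖y‖) :=
        add_le_add (Finset.sum_le_sum fun j _ => h1 j) (by linarith)
    _ = _ := by rw [← Finset.mul_sum, ← Finset.sum_mul]; ring

/-- `∫ (∑ⱼ aⱼ ∂ⱼy + ½ d y) b` in one integral. -/
lemma integral_eq_advect (a : L2V Ω) (d : L2 Ω) (y : Jet Ω) {b : E3 → ℝ} (hb : Continuous b)
    {K : ℝ} (hK : ∀ x, |b x| ≤ K) :
    ∫ x in Ω, ((∑ j, a j x * y.snd j x) + 1 / 2 * d x * y.fst x) * b x = advect a d y b := by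
  have h1 (j : Fin 3) := integrable_mul_mul (a j) (y.snd j) hb hK
  have h2 := (integrable_mul_mul d y.fst hb hK).const_mul (1 / 2)
  rw [advect, ← integral_finsetSum _ fun j _ => h1 j, ← integral_const_mul,
    ← integral_add (integrable_finsetSum _ fun j _ => h1 j) h2]
  refine integral_congr_ae (Eventually.of_forall fun x => ?_)
  simp only [add_mul, Finset.sum_mul]
  ring

lemma inner_L2V (g h : L2V Ω) : inner ℝ g h = ∑ j, inner ℝ (g j) (h j) := PiLp.inner_apply _ _

/-- Since `∇((1 - cos (sφ)) / s²) = (sin (sφ) / s) ∇φ`, the first-order part of the form integrates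
by parts to a zero-order one, and what remains vanishes as `s → 0`. -/
lemma abs_advect_jet_le {a : L2V Ω} {d : L2 Ω} (had : HasWeakDiv a d)
    (hφ : IsTestFunction Ω φ) {s : ℝ} (hs : 0 < s) :
    |advect a d (jet hφ) ((fun y : ℝ => Real.sin (s * y) / s) ∘ φ)|
      ≤ 3 * s * ‖d‖ * (eLpNorm φ 6 (volume.restrict Ω)).toReal ^ 3 := by
  set b : E3 → ℝ := (fun y : ℝ => Real.sin (s * y) / s) ∘ φ with hb_def
  set B : E3 → ℝ := (fun y : ℝ => (1 - Real.cos (s * y)) / s ^ 2) ∘ φ with hB_def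
  have hB : IsTestFunction Ω B := hφ.one_sub_cos_mul_div s
  have hb : IsTestFunction Ω b := hφ.sin_mul_div s
  have hdiv := had _ (jet_mem_testSpace hB)
  have e1 (j : Fin 3) : ∫ x in Ω, a j x * (jet hφ).snd j x * b x
      = inner ℝ (a j) ((jet hB).snd j) := by
    rw [inner_eq_integral]
    apply integral_congr_ae
    filter_upwards [coeFn_jet_snd hφ j, coeFn_jet_snd hB j] with x h1 h2
    rw [h1, h2, hB_def, partialDeriv_comp hφ (contDiff_one_sub_cos_mul_div s),
      deriv_one_sub_cos_mul_div hs.ne', hb_def]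
    simp only [Function.comp_apply]
    ring
  have hφb : MemLp (fun x => φ x * b x) 2 (volume.restrict Ω) := (hφ.mul hb).memLp _ 2
  have hE : MemLp (fun x => 1 / 2 * (φ x * b x) - B x) 2 (volume.restrict Ω) :=
    (hφb.const_mul (1 / 2)).sub (hB.memLp _ 2)
  have e2 : advect a d (jet hφ) b = ∫ x in Ω, d x * (1 / 2 * (φ x * b x) - B x) := by
    rw [advect, Finset.sum_congr rfl fun j _ => e1 j, ← inner_L2V, hdiv, inner_eq_integral,
      ← integral_const_mul, neg_add_eq_sub, ← integral_sub]
    · apply integral_congr_ae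
      filter_upwards [coeFn_jet_fst hφ, coeFn_jet_fst hB] with x h1 h2
      rw [h1, h2]
      ring
    · exact (integrable_mul_mul d _ hb.continuous hb.exists_bound.choose_spec.2).const_mul _
    · exact integrable_mul _ _
  have hpt (x : E3) : ‖1 / 2 * (φ x * b x) - B x‖ ≤ 3 * s * ‖|φ x| ^ 3‖ := by
    have h := abs_half_mul_sin_add_cos_sub_one_le (s * φ x)
    have e : 1 / 2 * (φ x * b x) - B x
        = (1 / 2 * (s * φ x) * Real.sin (s * φ x) + Real.cos (s * φ x) - 1) / s ^ 2 := by
      simp only [hb_def, hB_def, Function.comp_apply]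
      field_simp
      ring
    rw [e, norm_div, Real.norm_eq_abs, Real.norm_eq_abs (s ^ 2), abs_of_pos (pow_pos hs 2),
      div_le_iff₀ (by positivity), Real.norm_of_nonneg (by positivity)]
    refine h.trans (le_of_eq ?_)
    rw [abs_mul, abs_of_pos hs]
    ring
  have hN : (eLpNorm (fun x => 1 / 2 * (φ x * b x) - B x) 2 (volume.restrict Ω)).toReal
      ≤ 3 * s * (eLpNorm φ 6 (volume.restrict Ω)).toReal ^ 3 := by
    refine ENNReal.toReal_le_of_le_ofReal (by positivity) ?_
    refine (eLpNorm_le_mul_eLpNorm_of_ae_le_mul (Eventually.of_forall hpt) 2).trans (le_of_eq ?_)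
    rw [eLpNorm_abs_pow_three, ENNReal.ofReal_mul (p := 3 * s) (by positivity),
      ENNReal.ofReal_pow ENNReal.toReal_nonneg, ENNReal.ofReal_toReal (hφ.memLp _ 6).2.ne]
  rw [e2]
  refine (abs_integral_mul_le d hE).trans ?_
  calc ‖d‖ * _ ≤ ‖d‖ * (3 * s * (eLpNorm φ 6 (volume.restrict Ω)).toReal ^ 3) :=
        mul_le_mul_of_nonneg_left hN (norm_nonneg _)
    _ = _ := by ring

/-- The truncation `sin (sφ) / s` is close to `φ` in `H¹` when `s` is small and `φ` is close
to a test function `ψ` with bounded gradient. -/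
lemma norm_jet_sin_sub_snd_le (hφ : IsTestFunction Ω φ) (hψ : IsTestFunction Ω ψ) {s K : ℝ}
    (hs : 0 < s) {j : Fin 3} (hK : ∀ x, |partialDeriv j ψ x| ≤ K) :
    ‖(jet (hφ.sin_mul_div s) - jet hφ).snd j‖
      ≤ 2 * ‖jet hφ - jet hψ‖ + s * K * ‖jet hφ‖ := by
  have hK0 : 0 ≤ K := (abs_nonneg _).trans (hK 0)
  let G : L2 Ω := (2 : ℝ) • |(jet hφ - jet hψ).snd j| + (s * K) • |(jet hφ).fst|
  have hG : ‖(jet (hφ.sin_mul_div s) - jet hφ).snd j‖ ≤ ‖G‖ := by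
    refine Lp.norm_le_norm_of_ae_le ?_
    have e1 : (jet (hφ.sin_mul_div s) - jet hφ).snd j
        = (jet (hφ.sin_mul_div s)).snd j - (jet hφ).snd j := rfl
    have e2 : (jet hφ - jet hψ).snd j = (jet hφ).snd j - (jet hψ).snd j := rfl
    simp only [G, e1, e2]
    filter_upwards [Lp.coeFn_sub ((jet (hφ.sin_mul_div s)).snd j) ((jet hφ).snd j),
      Lp.coeFn_sub ((jet hφ).snd j) ((jet hψ).snd j),
      Lp.coeFn_add ((2 : ℝ) • |(jet hφ).snd j - (jet hψ).snd j|) ((s * K) • |(jet hφ).fst|),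
      Lp.coeFn_smul (2 : ℝ) |(jet hφ).snd j - (jet hψ).snd j|,
      Lp.coeFn_smul (s * K) |(jet hφ).fst|, Lp.coeFn_abs ((jet hφ).snd j - (jet hψ).snd j),
      Lp.coeFn_abs (jet hφ).fst, coeFn_jet_fst hφ, coeFn_jet_snd hφ j, coeFn_jet_snd hψ j,
      coeFn_jet_snd (hφ.sin_mul_div s) j] with x h1 h2 h3 h4 h5 h6 h7 h8 h9 h10 h11
    rw [h3, h1]
    simp only [Pi.add_apply, Pi.sub_apply, h4, h5, Pi.smul_apply, h6, h7, h2, h8, h9, h10, h11,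
      smul_eq_mul]
    rw [partialDeriv_comp hφ (contDiff_sin_mul_div s), deriv_sin_mul_div hs.ne']
    set p := partialDeriv j φ x
    set q := partialDeriv j ψ x
    set c := Real.cos (s * φ x)
    rw [Real.norm_eq_abs, Real.norm_of_nonneg (by positivity)]
    have hc1 : |c - 1| ≤ 2 := by
      rw [abs_le]
      constructor <;> linarith [Real.cos_le_one (s * φ x), Real.neg_one_le_cos (s * φ x)]
    have hc2 : |c - 1| ≤ s * |φ x| := by
      have := abs_cos_sub_one_le (s * φ x)
      rwa [abs_mul, abs_of_pos hs] at this
    calc |c * p - p| = |(c - 1) * (p - q) + (c - 1) * q| := by ring_nf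
      _ ≤ |c - 1| * |p - q| + |c - 1| * |q| := by
          rw [← abs_mul, ← abs_mul]; exact abs_add_le _ _
      _ ≤ 2 * |p - q| + s * |φ x| * K := by
          gcongr
          exact hK x
      _ = _ := by ring
  refine hG.trans ((norm_add_le _ _).trans ?_)
  rw [norm_smul, norm_smul, norm_abs_eq_norm, norm_abs_eq_norm, Real.norm_of_nonneg (by norm_num),
    Real.norm_of_nonneg (by positivity)]
  gcongr
  · exact norm_snd_apply_le _ j
  · exact norm_fst_le _

/-- Passage to the limit `t → 0+` in a bound depending continuously on `t`. -/
lemma le_of_forall_pos_lt_le {x r : ℝ} {g : ℝ → ℝ} (hr : 0 < r) (hg : Continuous g)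
    (h : ∀ t, 0 < t → t < r → x ≤ g t) : x ≤ g 0 := by
  refine ge_of_tendsto (hg.continuousWithinAt (s := Set.Ioi 0) (x := 0)) ?_
  filter_upwards [Ioo_mem_nhdsGT hr] with t ht
  exact h t ht.1 ht.2

/-- Skew-symmetry of the convection form. The form `w ↦ ∫ (a·∇v + ½ (∇·a) v) w` need not be
continuous on `H¹₀(Ω)` when `a` is merely square integrable; but if it agrees on test functions
with a continuous functional `ℓ`, then `ℓ v = 0`. -/
lemma functional_self_eq_zero (hΩ : Bornology.IsBounded Ω) {a : L2V Ω} {d : L2 Ω}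
    (had : HasWeakDiv a d) (v : H01 Ω) (ℓ : H01 Ω →L[ℝ] ℝ)
    (hℓ : ∀ ζ : H01 Ω, (ζ : Jet Ω) ∈ testSpace Ω → ℓ ζ =
      ∫ x in Ω, ((∑ j, a j x * (v : Jet Ω).snd j x) + 1 / 2 * d x * (v : Jet Ω).fst x)
        * (ζ : Jet Ω).fst x) :
    ℓ v = 0 := by
  obtain ⟨P, hP0, hP⟩ := exists_poincare hΩ
  obtain ⟨S, hS0, hS⟩ := exists_sobolev Ω
  set R := ‖(v : Jet Ω)‖ + 1
  set A := (∑ j, ‖a j‖) + ‖d‖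
  -- `ψ` is within `η` of `v` and stays fixed while `s` decreases; `φ` is within `δ` of `v`, where
  -- `δ` may be small compared with `s`.
  have key : ∀ η, 0 < η → ∃ K, ∀ s, 0 < s → ∀ δ, 0 < δ → δ < min η 1 →
      |ℓ v| ≤ ‖ℓ‖ * (δ + (P + 1) * (3 * (2 * (2 * η) + s * K * R)))
        + (s⁻¹ * (A * δ) + 3 * s * ‖d‖ * (S * R) ^ 3) := by
    intro η hη
    obtain ⟨ψ, hψ, hvψ⟩ := exists_jet_norm_sub_lt v.2 hη
    choose K hK0 hK using fun j => (hψ.partialDeriv j).exists_bound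
    have hKK (j : Fin 3) : ∀ x, |partialDeriv j ψ x| ≤ ∑ i, K i := fun x =>
      (hK j x).trans (Finset.single_le_sum (fun i _ => hK0 i) (Finset.mem_univ j))
    refine ⟨∑ i, K i, fun s hs δ hδ hδη => ?_⟩
    have hδ1 : δ < η := hδη.trans_le (min_le_left _ _)
    have hδ2 : δ < 1 := hδη.trans_le (min_le_right _ _)
    have hKs : 0 ≤ ∑ i, K i := Finset.sum_nonneg fun i _ => hK0 i
    obtain ⟨φ, hφ, hvφ⟩ := exists_jet_norm_sub_lt v.2 hδ
    have hb := hφ.sin_mul_div s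
    set b : E3 → ℝ := (fun y : ℝ => Real.sin (s * y) / s) ∘ φ
    have hbs (x : E3) : |b x| ≤ s⁻¹ := abs_sin_mul_div_le hs (φ x)
    have hφR : ‖jet hφ‖ ≤ R := by
      have : ‖jet hφ‖ ≤ ‖(v : Jet Ω)‖ + ‖(v : Jet Ω) - jet hφ‖ := norm_le_norm_add_norm_sub _ _
      linarith
    have hφψ : ‖jet hφ - jet hψ‖ ≤ 2 * η := by
      have : ‖jet hφ - jet hψ‖ ≤ ‖jet hφ - (v : Jet Ω)‖ + ‖(v : Jet Ω) - jet hψ‖ :=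
        norm_sub_le_norm_sub_add_norm_sub _ _ _
      rw [norm_sub_rev (jet hφ) (v : Jet Ω)] at this
      linarith
    have h1 : ‖jet hb - jet hφ‖ ≤ (P + 1) * (3 * (2 * (2 * η) + s * (∑ i, K i) * R)) := by
      have hm : jet hb - jet hφ ∈ H01 Ω :=
        sub_mem (testSpace_le_H01 (jet_mem_testSpace hb)) (testSpace_le_H01 (jet_mem_testSpace hφ))
      have h2 : ‖(jet hb - jet hφ).snd‖ ≤ 3 * (2 * (2 * η) + s * (∑ i, K i) * R) := by
        refine (norm_L2V_le_sum _).trans ?_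
        have h3 (j : Fin 3) : ‖(jet hb - jet hφ).snd j‖ ≤ 2 * (2 * η) + s * (∑ i, K i) * R :=
          (norm_jet_sin_sub_snd_le hφ hψ hs (hKK j)).trans (by gcongr)
        refine (Finset.sum_le_sum fun j _ => h3 j).trans (le_of_eq ?_)
        rw [Finset.sum_const, Finset.card_fin, nsmul_eq_mul, Nat.cast_ofNat]
      calc ‖jet hb - jet hφ‖ ≤ ‖(jet hb - jet hφ).fst‖ + ‖(jet hb - jet hφ).snd‖ := norm_jet_le _
        _ ≤ (P + 1) * ‖(jet hb - jet hφ).snd‖ := by linarith [hP _ hm]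
        _ ≤ _ := by gcongr
    let ζ : H01 Ω := ⟨jet hb, testSpace_le_H01 (jet_mem_testSpace hb)⟩
    have h4 : ‖v - ζ‖ ≤ δ + (P + 1) * (3 * (2 * (2 * η) + s * (∑ i, K i) * R)) := by
      have : ‖(v : Jet Ω) - jet hb‖ ≤ ‖(v : Jet Ω) - jet hφ‖ + ‖jet hφ - jet hb‖ :=
        norm_sub_le_norm_sub_add_norm_sub _ _ _
      rw [norm_sub_rev (jet hφ)] at this
      change ‖(v : Jet Ω) - jet hb‖ ≤ _
      linarith
    have h5 : ℓ ζ = advect a d (v - jet hφ) b + advect a d (jet hφ) b := by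
      rw [advect_sub a d _ _ hb.continuous hbs, sub_add_cancel,
        ← integral_eq_advect a d _ hb.continuous hbs, hℓ ζ (jet_mem_testSpace hb)]
      apply integral_congr_ae
      filter_upwards [coeFn_jet_fst hb] with x hx
      rw [← hx]
    have h6 : |advect a d (v - jet hφ) b| ≤ s⁻¹ * (A * δ) :=
      (abs_advect_le a d _ hb.continuous hbs).trans (by gcongr)
    have h7 : |advect a d (jet hφ) b| ≤ 3 * s * ‖d‖ * (S * R) ^ 3 := by
      refine (abs_advect_jet_le had hφ hs).trans ?_
      gcongr
      exact (hS φ hφ).trans (by gcongr; exact (norm_snd_le _).trans hφR)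
    have h8 : |ℓ (v - ζ)| ≤ ‖ℓ‖ * (δ + (P + 1) * (3 * (2 * (2 * η) + s * (∑ i, K i) * R))) :=
      (ℓ.le_opNorm _).trans (by gcongr)
    have h9 : ℓ v = ℓ (v - ζ) + (advect a d (v - jet hφ) b + advect a d (jet hφ) b) := by
      rw [← h5, map_sub, sub_add_cancel]
    rw [h9]
    exact (abs_add_le _ _).trans (add_le_add h8 ((abs_add_le _ _).trans (add_le_add h6 h7)))
  -- The parameters tend to zero one after the other: first `δ`, then `s`, then `η`.
  have key2 (η : ℝ) (hη : 0 < η) : |ℓ v| ≤ ‖ℓ‖ * ((P + 1) * (3 * (2 * (2 * η)))) := by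
    obtain ⟨K, hK⟩ := key η hη
    have hδ (s : ℝ) (hs : 0 < s) := le_of_forall_pos_lt_le (lt_min hη one_pos)
      (g := fun δ => ‖ℓ‖ * (δ + (P + 1) * (3 * (2 * (2 * η) + s * K * R)))
        + (s⁻¹ * (A * δ) + 3 * s * ‖d‖ * (S * R) ^ 3)) (by fun_prop) (hK s hs)
    have hs := le_of_forall_pos_lt_le one_pos
      (g := fun s => ‖ℓ‖ * ((P + 1) * (3 * (2 * (2 * η) + s * K * R)))
        + 3 * s * ‖d‖ * (S * R) ^ 3) (by fun_prop) fun s hs _ => by simpa using hδ s hs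
    simpa using hs
  have h := le_of_forall_pos_lt_le one_pos
    (g := fun η => ‖ℓ‖ * ((P + 1) * (3 * (2 * (2 * η))))) (by fun_prop) fun η hη _ => key2 η hη
  simp only [mul_zero] at h
  exact abs_nonpos_iff.1 h

/-! ### Vector fields -/

/-- The inclusion of `H¹₀(Ω)` in `H¹₀(Ω)³` as the fields whose `i`-th component alone may not
vanish. -/
noncomputable def inclV (i : Fin 3) : H01 Ω →L[ℝ] H01V Ω :=
  (PiLp.continuousLinearEquiv 2 ℝ fun _ : Fin 3 => H01 Ω).symm.toContinuousLinearMap ∘L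
    ContinuousLinearMap.single ℝ (fun _ : Fin 3 => H01 Ω) i

lemma inclV_apply (i j : Fin 3) (z : H01 Ω) :
    (inclV i z : H01V Ω) j = if j = i then z else 0 := by
  simp [inclV]

lemma sum_inclV (v : H01V Ω) : ∑ i, inclV i (v i) = v := by
  ext1 j
  rw [WithLp.ofLp_sum, Finset.sum_apply]
  simp only [inclV_apply]
  simp

/-- `valV` as a continuous linear map. -/
noncomputable def valVL : H01V Ω →L[ℝ] L2V Ω where
  toFun := valV
  map_add' _ _ := rfl
  map_smul' _ _ := rfl
  cont := by unfold valV; fun_prop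

/-- `gradV` as a continuous linear map. -/
noncomputable def gradVL (i : Fin 3) : H01V Ω →L[ℝ] L2V Ω where
  toFun v := gradV v i
  map_add' _ _ := rfl
  map_smul' _ _ := rfl
  cont := by unfold gradV; fun_prop

lemma convection_inclV (a : L2V Ω) (d : L2 Ω) (v : H01V Ω) (i : Fin 3) (ζ : H01 Ω) :
    convection a d v (inclV i ζ) =
      ∫ x in Ω, ((∑ j, a j x * (v i : Jet Ω).snd j x) + 1 / 2 * d x * (v i : Jet Ω).fst x)
        * (ζ : Jet Ω).fst x := by
  apply integral_congr_ae
  filter_upwards [Lp.coeFn_zero ℝ 2 (volume.restrict Ω)] with x hx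
  have h (j : Fin 3) : valV (inclV i ζ) j x = if j = i then (ζ : Jet Ω).fst x else 0 := by
    change ((inclV i ζ : H01V Ω) j : Jet Ω).fst x = _
    rw [inclV_apply]
    split_ifs
    · rfl
    · exact hx
  simp only [h, mul_ite, mul_zero, Finset.sum_ite_eq', Finset.mem_univ, if_true]
  rfl

/-- Skew-symmetry of the convection form for vector fields, by components. -/
lemma functional_self_eq_zero_of_eq_convection (hΩ : Bornology.IsBounded Ω) {a : L2V Ω}
    {d : L2 Ω} (had : HasWeakDiv a d) (v : H01V Ω) (ℓ : Hm1V Ω)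
    (hℓ : ∀ w : H01V Ω, (∀ i, (w i : Jet Ω) ∈ testSpace Ω) → ℓ w = convection a d v w) :
    ℓ v = 0 := by
  rw [← sum_inclV v, map_sum]
  refine Finset.sum_eq_zero fun i _ => ?_
  refine functional_self_eq_zero hΩ had (v i) (ℓ ∘L inclV i) fun ζ hζ => ?_
  rw [← convection_inclV]
  refine hℓ _ fun j => ?_
  change (((inclV i ζ : H01V Ω) j : H01 Ω) : Jet Ω) ∈ _
  rw [inclV_apply]
  split_ifs
  · exact hζ
  · exact (testSpace Ω).zero_mem

lemma norm_H01V_sq_le {P : ℝ} (hP : ∀ z ∈ H01 Ω, ‖z.fst‖ ≤ P * ‖z.snd‖)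
    (v : H01V Ω) : ‖v‖ ^ 2 ≤ (P ^ 2 + 1) * ∑ i, ‖gradV v i‖ ^ 2 := by
  rw [PiLp.norm_sq_eq_of_L2, Finset.mul_sum]
  refine Finset.sum_le_sum fun i _ => ?_
  have e : ‖v i‖ ^ 2 = ‖(v i : Jet Ω).fst‖ ^ 2 + ‖(v i : Jet Ω).snd‖ ^ 2 :=
    WithLp.prod_norm_sq_eq_of_L2 (v i : Jet Ω)
  have h := pow_le_pow_left₀ (norm_nonneg _) (hP _ (v i).2) 2
  rw [e]
  change _ ≤ (P ^ 2 + 1) * ‖(v i : Jet Ω).snd‖ ^ 2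
  linarith [mul_pow P ‖(v i : Jet Ω).snd‖ 2]

/-! ### The projection step -/

/-- Green's formula for `v ∈ H¹₀(Ω)³` and `q ∈ H¹(Ω)`. -/
lemma inner_valV_gradH1 (v : H01V Ω) (q : H1 Ω) :
    inner ℝ (valV v) (gradH1 q) = inner ℝ (-∑ i, gradV v i i) (valH1 q) := by
  rw [inner_L2V, inner_neg_left, sum_inner, ← Finset.sum_neg_distrib]
  refine Finset.sum_congr rfl fun i _ => ?_
  have h := inner_fst_snd_of_mem_H01 q.2 (v i).2 i
  rw [real_inner_comm] at h
  rw [real_inner_comm]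
  change inner ℝ ((q : Jet Ω).snd i) (v i : Jet Ω).fst =
    -inner ℝ ((v i : Jet Ω).snd i) (q : Jet Ω).fst
  rw [h, neg_neg]

lemma norm_sum_gradV_diag_sq_le (v : H01V Ω) :
    ‖-∑ i, gradV v i i‖ ^ 2 ≤ 3 * ∑ i, ‖gradV v i‖ ^ 2 := by
  rw [norm_neg]
  calc ‖∑ i, gradV v i i‖ ^ 2 ≤ (∑ i, ‖gradV v i‖) ^ 2 := by
        refine pow_le_pow_left₀ (norm_nonneg _) ((norm_sum_le _ _).trans ?_) 2
        exact Finset.sum_le_sum fun i _ => PiLp.norm_apply_le (gradV v i) i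
    _ ≤ 3 * ∑ i, ‖gradV v i‖ ^ 2 := by
        have := sq_sum_le_card_mul_sum_sq (s := Finset.univ) (f := fun i : Fin 3 => ‖gradV v i‖)
        simpa using this

/-- The Helmholtz projection maps `H¹₀(Ω)³` to `H¹(Ω)³`: the potential `q` of `v - u` solves the
homogeneous Neumann problem with right-hand side `-∇·v`, so that `∇q ∈ H¹(Ω)³`. -/
lemma exists_H1_of_projection {c : ℝ} (hc0 : 0 ≤ c)
    (hc : ∀ (g : L2 Ω) (φ : H1 Ω),
      (∀ q : H1 Ω, inner ℝ (gradH1 φ) (gradH1 q) = inner ℝ g (valH1 q)) →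
      ∃ D : Fin 3 → H1 Ω, (∀ j, valH1 (D j) = gradH1 φ j) ∧
        ∑ j, ‖gradH1 (D j)‖ ^ 2 ≤ c * ‖g‖ ^ 2)
    (v : H01V Ω) {u : L2V Ω} (hu : u ∈ solenoidal Ω) (q : H1 Ω) (hq : u + gradH1 q = valV v) :
    ∃ U : Fin 3 → H1 Ω, (∀ i, valH1 (U i) = u i) ∧
      ∑ i, ‖gradH1 (U i)‖ ^ 2 ≤ (2 + 6 * c) * ∑ i, ‖gradV v i‖ ^ 2 := by
  obtain ⟨D, hD, hDg⟩ := hc (-∑ i, gradV v i i) q fun r => by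
    rw [← inner_valV_gradH1, ← hq, inner_add_left, hu.2 r, zero_add]
  refine ⟨fun i => ⟨(v i : Jet Ω), H01_le_H1 (v i).2⟩ - D i, fun i => ?_, ?_⟩
  · have e : u i = valV v i - gradH1 q i := by rw [← hq]; exact (add_sub_cancel_right _ _).symm
    rw [e, ← hD i]
    rfl
  · have h (i : Fin 3) : ‖gradH1 ((⟨(v i : Jet Ω), H01_le_H1 (v i).2⟩ : H1 Ω) - D i)‖ ^ 2
        ≤ 2 * ‖gradV v i‖ ^ 2 + 2 * ‖gradH1 (D i)‖ ^ 2 := by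
      change ‖gradV v i - gradH1 (D i)‖ ^ 2 ≤ _
      have h1 := norm_sub_le (gradV v i) (gradH1 (D i))
      have h2 := pow_le_pow_left₀ (norm_nonneg _) h1 2
      linarith [sq_nonneg (‖gradV v i‖ - ‖gradH1 (D i)‖)]
    refine (Finset.sum_le_sum fun i _ => h i).trans ?_
    rw [Finset.sum_add_distrib, ← Finset.mul_sum, ← Finset.mul_sum]
    have h3 := mul_le_mul_of_nonneg_left (norm_sum_gradV_diag_sq_le v) hc0
    linarith

/-! ### The forcing -/

/-- The Cauchy-Schwarz inequality for a vector-valued integrand against the constant `1`. -/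
lemma sq_norm_intervalIntegral_le {E : Type*} [NormedAddCommGroup E] [NormedSpace ℝ E]
    {f : ℝ → E} {a b : ℝ} (hab : a < b) (hf : IntervalIntegrable f volume a b)
    (hf2 : IntervalIntegrable (fun t => ‖f t‖ ^ 2) volume a b) :
    ‖∫ t in a..b, f t‖ ^ 2 ≤ (b - a) * ∫ t in a..b, ‖f t‖ ^ 2 := by
  set I := ∫ t in a..b, ‖f t‖
  have h1 : ‖∫ t in a..b, f t‖ ≤ I := intervalIntegral.norm_integral_le_integral_norm hab.le
  have h2 (c : ℝ) : 2 * c * I ≤ (∫ t in a..b, ‖f t‖ ^ 2) + (b - a) * c ^ 2 := by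
    have h := intervalIntegral.integral_mono_on hab.le (hf.norm.const_mul (2 * c))
      (hf2.add (intervalIntegrable_const (c := c ^ 2))) fun t _ => by
        nlinarith [sq_nonneg (‖f t‖ - c)]
    rwa [intervalIntegral.integral_const_mul, intervalIntegral.integral_add hf2
      intervalIntegrable_const, intervalIntegral.integral_const, smul_eq_mul] at h
  have hba : 0 < b - a := sub_pos.2 hab
  -- The weight `c` of Young's inequality is the mean of `‖f‖`.
  have h3 := h2 (I / (b - a))
  have h4 : I ^ 2 / (b - a) ≤ ∫ t in a..b, ‖f t‖ ^ 2 := by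
    have e1 : 2 * (I / (b - a)) * I = 2 * (I ^ 2 / (b - a)) := by ring
    have e2 : (b - a) * (I / (b - a)) ^ 2 = I ^ 2 / (b - a) := by field_simp
    rw [e1, e2] at h3
    linarith
  rw [div_le_iff₀ hba] at h4
  exact (pow_le_pow_left₀ (norm_nonneg _) h1 2).trans (by linarith)

/-- Averaging over the cells of a uniform partition does not increase the `L²` norm. -/
lemma sum_sq_norm_cell_average_le {E : Type*} [NormedAddCommGroup E] [NormedSpace ℝ E]
    {T : ℝ} (hT : 0 < T) {f : ℝ → E}
    (hf : MemLp f 2 (volume.restrict (Set.Ioo 0 T))) {M : ℕ} (hM : 1 ≤ M) :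
    T / M * ∑ m ∈ Finset.range M,
      ‖(T / M)⁻¹ • ∫ t in (((m + 1 : ℕ) : ℝ) - 1) * (T / M)..((m + 1 : ℕ) * (T / M)), f t‖ ^ 2
        ≤ ∫ t in (0 : ℝ)..T, ‖f t‖ ^ 2 := by
  have hM0 : (0 : ℝ) < M := by exact_mod_cast hM
  set k := T / M with hk_def
  have hk : 0 < k := div_pos hT hM0
  have hMk : M * k = T := by rw [hk_def]; field_simp
  have hi1 : IntervalIntegrable f volume 0 T := by
    rw [intervalIntegrable_iff_integrableOn_Ioo_of_le hT.le]
    exact hf.integrable (by norm_num)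
  have hi2 : IntervalIntegrable (fun t => ‖f t‖ ^ 2) volume 0 T := by
    rw [intervalIntegrable_iff_integrableOn_Ioo_of_le hT.le]
    exact hf.integrable_norm_pow (by norm_num)
  have hsub (m : ℕ) (hm : m < M) :
      Set.uIcc ((m : ℝ) * k) ((m + 1 : ℕ) * k) ⊆ Set.uIcc 0 T := by
    have h1 : ((m + 1 : ℕ) : ℝ) ≤ M := by exact_mod_cast hm
    rw [Set.uIcc_of_le hT.le, Set.uIcc_of_le (by gcongr; simp)]
    refine Set.Icc_subset_Icc (by positivity) ?_
    rw [← hMk]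
    gcongr
  have hcell (m : ℕ) (hm : m < M) :
      k * ‖k⁻¹ • ∫ t in (((m + 1 : ℕ) : ℝ) - 1) * k..((m + 1 : ℕ) * k), f t‖ ^ 2
      ≤ ∫ t in ((m : ℝ) * k)..((m + 1 : ℕ) * k), ‖f t‖ ^ 2 := by
    have hlt : (m : ℝ) * k < (m + 1 : ℕ) * k := by gcongr; simp
    have h := sq_norm_intervalIntegral_le hlt (hi1.mono_set (hsub m hm)) (hi2.mono_set (hsub m hm))
    have e1 : ((m + 1 : ℕ) : ℝ) * k - m * k = k := by push_cast; ring
    have e2 : (((m + 1 : ℕ) : ℝ) - 1) * k = m * k := by push_cast; ring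
    rw [e1] at h
    rw [e2, norm_smul, norm_inv, Real.norm_of_nonneg hk.le, mul_pow]
    calc k * (k⁻¹ ^ 2 * _) = k⁻¹ * ‖∫ t in ((m : ℝ) * k)..((m + 1 : ℕ) * k), f t‖ ^ 2 := by
          field_simp
      _ ≤ k⁻¹ * (k * ∫ t in ((m : ℝ) * k)..((m + 1 : ℕ) * k), ‖f t‖ ^ 2) := by gcongr
      _ = _ := by field_simp
  rw [Finset.mul_sum]
  refine (Finset.sum_le_sum fun m hm => hcell m (Finset.mem_range.1 hm)).trans (le_of_eq ?_)
  rw [intervalIntegral.sum_integral_adjacent_intervals (a := fun m : ℕ => (m : ℝ) * k)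
    fun m hm => hi2.mono_set (hsub m hm), hMk]
  simp

lemma IsForcing.exists_bound {T : ℝ} (hT : 0 < T) {f : ℝ → Hm1V Ω}
    (hf : MemLp f 2 (volume.restrict (Set.Ioo 0 T))) {F : ℕ → ℕ → Hm1V Ω} (hF : IsForcing T f F) :
    ∃ B, 0 ≤ B ∧ ∀ M : ℕ, 1 ≤ M →
      T / M * ∑ m ∈ Finset.range M, ‖F M (m + 1)‖ ^ 2 ≤ B := by
  rcases hF with ⟨rfl, B, hB⟩ | rfl
  · refine ⟨max B 0, le_max_right _ _, fun M hM => le_max_of_le_left ?_⟩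
    refine le_trans (le_of_eq ?_) (hB M hM)
    have e : Finset.Icc 1 M = Finset.Ico (0 + 1) (M + 1) := by
      ext m
      simp only [Finset.mem_Icc, Finset.mem_Ico]
      omega
    rw [e, ← Finset.sum_Ico_add' (fun m => ‖pointValues T f M m‖ ^ 2) 0 M 1, Finset.range_eq_Ico]
  · exact ⟨∫ t in (0 : ℝ)..T, ‖f t‖ ^ 2,
      intervalIntegral.integral_nonneg hT.le fun _ _ => by positivity,
      fun M hM => sum_sq_norm_cell_average_le hT hf hM⟩

/-! ### The energy estimate -/

section Energy

variable {k : ℝ} {M : ℕ} {u₀ : L2V Ω} {F : ℕ → Hm1V Ω} {ut : ℕ → L2V Ω} {V : ℕ → H01V Ω}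
  {u : ℕ → L2V Ω} {p : ℕ → H1 Ω}

/-- The momentum equation tested with `ũ^{m+1}`. -/
lemma IsIterates.energy_eq (hΩ : Bornology.IsBounded Ω) (h : IsIterates k M u₀ F ut V u p)
    {m : ℕ} (hm : m < M) :
    1 / k * inner ℝ (ut (m + 1) - u m) (ut (m + 1)) + (∑ i, ‖gradV (V (m + 1)) i‖ ^ 2)
      + inner ℝ (gradH1 (p m)) (ut (m + 1)) = F (m + 1) (V (m + 1)) := by
  obtain ⟨d, hd, hw⟩ := h.step_one m hm
  -- All terms of the equation but the convection form are continuous in the test field.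
  let ℓ : Hm1V Ω := F (m + 1) - (1 / k) • (innerSL ℝ (ut (m + 1) - u m) ∘L valVL)
    - (∑ i, innerSL ℝ (gradV (V (m + 1)) i) ∘L gradVL i) - innerSL ℝ (gradH1 (p m)) ∘L valVL
  have e (w : H01V Ω) : ℓ w = F (m + 1) w - 1 / k * inner ℝ (ut (m + 1) - u m) (valV w)
      - (∑ i, inner ℝ (gradV (V (m + 1)) i) (gradV w i)) - inner ℝ (gradH1 (p m)) (valV w) := by
    simp only [ℓ, sub_apply, smul_apply, sum_apply, ContinuousLinearMap.comp_apply,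
      innerSL_apply_apply, smul_eq_mul]
    rfl
  have h0 := functional_self_eq_zero_of_eq_convection hΩ hd (V (m + 1)) ℓ fun w hwt => by
    rw [e, ← hw w hwt]
    ring
  rw [e, ← h.ut_eq m hm] at h0
  simp only [real_inner_self_eq_norm_sq] at h0
  linarith

/-- The projection step, with `ũ^{m+1}` split into its solenoidal part and a gradient. -/
lemma IsIterates.projection_eq (hk : 0 < k) (h : IsIterates k M u₀ F ut V u p)
    {m : ℕ} (hm : m < M) :
    u (m + 1) + (k • gradH1 (p (m + 1)) - k • gradH1 (p m)) = ut (m + 1) := by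
  have h2 := congrArg (k • ·) (h.step_two m hm)
  have e : gradH1 (p (m + 1) - p m) = gradH1 (p (m + 1)) - gradH1 (p m) := rfl
  simp only [e, smul_add, smul_smul, mul_one_div_cancel hk.ne', one_smul, smul_zero, smul_sub] at h2
  rw [← sub_eq_zero, ← h2]
  abel

/-- The energy `|u^m|² + |k∇p^m|²` grows by the work of the forcing at most. -/
lemma IsIterates.energy_step (hΩ : Bornology.IsBounded Ω) (hk : 0 < k) {P : ℝ}
    (hP : ∀ z ∈ H01 Ω, ‖z.fst‖ ≤ P * ‖z.snd‖) (h : IsIterates k M u₀ F ut V u p)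
    {m : ℕ} (hm : m < M) :
    ‖u (m + 1)‖ ^ 2 + ‖k • gradH1 (p (m + 1))‖ ^ 2 + k * ∑ i, ‖gradV (V (m + 1)) i‖ ^ 2
      ≤ ‖u m‖ ^ 2 + ‖k • gradH1 (p m)‖ ^ 2 + (P ^ 2 + 1) * (k * ‖F (m + 1)‖ ^ 2) := by
  set N := ∑ i, ‖gradV (V (m + 1)) i‖ ^ 2
  have h1 := h.energy_eq hΩ hm
  have h2 : inner ℝ (ut (m + 1) - u m) (ut (m + 1)) + k * N
      + inner ℝ (k • gradH1 (p m)) (ut (m + 1)) = k * F (m + 1) (V (m + 1)) := by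
    rw [← h1, real_inner_smul_left, mul_add, mul_add, ← mul_assoc, mul_one_div_cancel hk.ne',
      one_mul]
  have h3 : u (m + 1) + k • gradH1 (p (m + 1)) = ut (m + 1) + k • gradH1 (p m) := by
    rw [← h.projection_eq hk hm]
    abel
  -- On the left the two terms are orthogonal; on the right the cross term is the pressure term
  -- of `h2`.
  have h4 := congrArg (‖·‖ ^ 2) h3
  simp only [norm_add_sq_real] at h4
  rw [real_inner_smul_right, (h.mem_solenoidal m hm).2, real_inner_comm] at h4
  have h5 : 2 * inner ℝ (ut (m + 1) - u m) (ut (m + 1))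
      = ‖ut (m + 1)‖ ^ 2 + ‖ut (m + 1) - u m‖ ^ 2 - ‖u m‖ ^ 2 := by
    rw [norm_sub_sq_real, inner_sub_left, real_inner_self_eq_norm_sq, real_inner_comm]
    ring
  have h6 : 2 * F (m + 1) (V (m + 1)) ≤ (P ^ 2 + 1) * ‖F (m + 1)‖ ^ 2 + N := by
    have h7 := (le_abs_self _).trans ((F (m + 1)).le_opNorm (V (m + 1)))
    have h8 := norm_H01V_sq_le hP (V (m + 1))
    have hQ : 0 < P ^ 2 + 1 := by positivity
    have h9 : ‖V (m + 1)‖ ^ 2 / (P ^ 2 + 1) ≤ N := by rwa [div_le_iff₀' hQ]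
    have h10 : 2 * (‖F (m + 1)‖ * ‖V (m + 1)‖)
        ≤ (P ^ 2 + 1) * ‖F (m + 1)‖ ^ 2 + ‖V (m + 1)‖ ^ 2 / (P ^ 2 + 1) := by
      rw [← sub_nonneg]
      have e : (P ^ 2 + 1) * ‖F (m + 1)‖ ^ 2 + ‖V (m + 1)‖ ^ 2 / (P ^ 2 + 1)
          - 2 * (‖F (m + 1)‖ * ‖V (m + 1)‖)
          = ((P ^ 2 + 1) * ‖F (m + 1)‖ - ‖V (m + 1)‖) ^ 2 / (P ^ 2 + 1) := by
        field_simp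
        ring
      rw [e]
      positivity
    linarith
  have h11 := mul_le_mul_of_nonneg_left h6 hk.le
  linarith [sq_nonneg ‖ut (m + 1) - u m‖]

lemma IsIterates.energy_le (hΩ : Bornology.IsBounded Ω) (hk : 0 < k) {P : ℝ}
    (hP : ∀ z ∈ H01 Ω, ‖z.fst‖ ≤ P * ‖z.snd‖) (h : IsIterates k M u₀ F ut V u p)
    {r : ℕ} (hr : r ≤ M) :
    ‖u r‖ ^ 2 + ‖k • gradH1 (p r)‖ ^ 2
        + k * ∑ m ∈ Finset.range r, ∑ i, ‖gradV (V (m + 1)) i‖ ^ 2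
      ≤ ‖u₀‖ ^ 2 + ‖k • gradH1 (p 0)‖ ^ 2
        + (P ^ 2 + 1) * (k * ∑ m ∈ Finset.range r, ‖F (m + 1)‖ ^ 2) := by
  induction r with
  | zero => simp [h.u_zero]
  | succ r ih =>
    have h1 := ih (by omega)
    have h2 := h.energy_step hΩ hk hP (m := r) hr
    rw [Finset.sum_range_succ, Finset.sum_range_succ]
    linarith

end Energy

end ProjectionScheme

theorem mainTheorem7 (Ω : Set ProjectionScheme.E3) (hΩo : IsOpen Ω) (hΩc : IsConnected Ω)
    (hΩb : Bornology.IsBounded Ω) (hΩr : ProjectionScheme.NeumannH2Regular Ω)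
    (T : ℝ) (hT : 0 < T)
    (f : ℝ → ProjectionScheme.Hm1V Ω) (hf : MemLp f 2 (volume.restrict (Set.Ioo 0 T)))
    (F : ℕ → ℕ → ProjectionScheme.Hm1V Ω) (hF : ProjectionScheme.IsForcing T f F)
    (u₀ : ProjectionScheme.L2V Ω) (hu₀ : u₀ ∈ ProjectionScheme.solenoidal Ω) (C₀ : ℝ) :
    ∃ C : ℝ, 0 < C ∧ ∀ M : ℕ, 1 ≤ M → ∀ k : ℝ, k = T / M →
      ∀ (ut : ℕ → ProjectionScheme.L2V Ω) (V : ℕ → ProjectionScheme.H01V Ω)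
        (u : ℕ → ProjectionScheme.L2V Ω) (p : ℕ → ProjectionScheme.H1 Ω),
        ProjectionScheme.IsIterates k M u₀ (F M) ut V u p →
        k * ‖ProjectionScheme.gradH1 (p 0)‖ ≤ C₀ →
        (∀ r < M, ‖ut (r + 1)‖ ^ 2 + ‖u (r + 1)‖ ^ 2
            + ‖k • ProjectionScheme.gradH1 (p (r + 1))‖ ^ 2 ≤ C) ∧
        ∃ U : ℕ → Fin 3 → ProjectionScheme.H1 Ω,
          (∀ m < M, ∀ i, ProjectionScheme.valH1 (U (m + 1) i) = u (m + 1) i) ∧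
          k * ∑ m ∈ Finset.range M,
            ((∑ i, ‖ProjectionScheme.gradV (V (m + 1)) i‖ ^ 2)
              + ∑ i, ‖ProjectionScheme.gradH1 (U (m + 1) i)‖ ^ 2) ≤ C := by
  obtain ⟨P, hP0, hP⟩ := ProjectionScheme.exists_poincare hΩb
  obtain ⟨c', hc'⟩ := hΩr
  -- The constant of the regularity hypothesis may be negative.
  set c := max c' 0
  have hc0 : 0 ≤ c := le_max_right _ _
  have hc (g : ProjectionScheme.L2 Ω) (φ : ProjectionScheme.H1 Ω)
      (hφ : ∀ q : ProjectionScheme.H1 Ω, inner ℝ (ProjectionScheme.gradH1 φ)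
        (ProjectionScheme.gradH1 q) = inner ℝ g (ProjectionScheme.valH1 q)) :
      ∃ D : Fin 3 → ProjectionScheme.H1 Ω,
        (∀ j, ProjectionScheme.valH1 (D j) = ProjectionScheme.gradH1 φ j) ∧
        ∑ j, ‖ProjectionScheme.gradH1 (D j)‖ ^ 2 ≤ c * ‖g‖ ^ 2 := by
    obtain ⟨D, hD, hD2⟩ := hc' g φ hφ
    exact ⟨D, hD, hD2.trans (mul_le_mul_of_nonneg_right (le_max_left _ _) (sq_nonneg _))⟩
  obtain ⟨B, hB0, hB⟩ := hF.exists_bound hT hf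
  set K := ‖u₀‖ ^ 2 + C₀ ^ 2 + (P ^ 2 + 1) * B
  have hK0 : 0 ≤ K := by positivity
  -- `|u|² + |k∇p|²` is at most `K`, whence `|ũ|² ≤ 6 K`; the gradients contribute `(3 + 6 c) K`,
  -- and the summand `1` makes the constant positive.
  refine ⟨(7 + 6 * c) * K + 1, by positivity, fun M hM k hk ut V u p h hp => ?_⟩
  have hk0 : 0 < k := by rw [hk]; exact div_pos hT (by exact_mod_cast hM)
  have hp0 : ‖k • ProjectionScheme.gradH1 (p 0)‖ ^ 2 ≤ C₀ ^ 2 := by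
    rw [norm_smul, Real.norm_of_nonneg hk0.le]
    exact pow_le_pow_left₀ (by positivity) hp 2
  have hE (r : ℕ) (hr : r ≤ M) : ‖u r‖ ^ 2 + ‖k • ProjectionScheme.gradH1 (p r)‖ ^ 2
      + k * ∑ m ∈ Finset.range r, ∑ i, ‖ProjectionScheme.gradV (V (m + 1)) i‖ ^ 2 ≤ K := by
    have h1 : k * ∑ m ∈ Finset.range r, ‖F M (m + 1)‖ ^ 2 ≤ B := by
      refine le_trans ?_ (hB M hM)
      rw [hk]
      gcongr
    have h2 := mul_le_mul_of_nonneg_left h1 (by positivity : 0 ≤ P ^ 2 + 1)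
    linarith [h.energy_le hΩb hk0 hP hr]
  have hE' (r : ℕ) (hr : r ≤ M) :
      ‖u r‖ ^ 2 + ‖k • ProjectionScheme.gradH1 (p r)‖ ^ 2 ≤ K := by
    have : 0 ≤ k * ∑ m ∈ Finset.range r, ∑ i, ‖ProjectionScheme.gradV (V (m + 1)) i‖ ^ 2 := by
      positivity
    linarith [hE r hr]
  have hcK : 0 ≤ c * K := mul_nonneg hc0 hK0
  refine ⟨fun r hr => ?_, ?_⟩
  · have h1 : ‖ut (r + 1)‖ ≤ ‖u (r + 1)‖ + (‖k • ProjectionScheme.gradH1 (p (r + 1))‖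
        + ‖k • ProjectionScheme.gradH1 (p r)‖) := by
      rw [← h.projection_eq hk0 hr]
      exact (norm_add_le _ _).trans (by gcongr; exact norm_sub_le _ _)
    set x := ‖u (r + 1)‖
    set y := ‖k • ProjectionScheme.gradH1 (p (r + 1))‖
    set z := ‖k • ProjectionScheme.gradH1 (p r)‖
    have h2 := pow_le_pow_left₀ (norm_nonneg _) h1 2
    have h3 : x ^ 2 + y ^ 2 ≤ K := hE' (r + 1) hr
    have h4 : z ^ 2 ≤ K := by linarith [hE' r hr.le, sq_nonneg ‖u r‖]
    nlinarith [sq_nonneg (x - y), sq_nonneg (x - z), sq_nonneg (y - z)]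
  · have hU (m : ℕ) : ∃ W : Fin 3 → ProjectionScheme.H1 Ω, m < M →
        (∀ i, ProjectionScheme.valH1 (W i) = u (m + 1) i) ∧
        ∑ i, ‖ProjectionScheme.gradH1 (W i)‖ ^ 2
          ≤ (2 + 6 * c) * ∑ i, ‖ProjectionScheme.gradV (V (m + 1)) i‖ ^ 2 := by
      by_cases hm : m < M
      · obtain ⟨W, hW⟩ := ProjectionScheme.exists_H1_of_projection hc0 hc (V (m + 1))
          (h.mem_solenoidal m hm) (k • (p (m + 1) - p m)) (by
            rw [← h.ut_eq m hm, ← h.projection_eq hk0 hm, ← smul_sub]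
            rfl)
        exact ⟨W, fun _ => hW⟩
      · exact ⟨0, fun h' => absurd h' hm⟩
    choose W hW using hU
    refine ⟨fun m => W (m - 1), fun m hm i => (hW m hm).1 i, ?_⟩
    set N := ∑ m ∈ Finset.range M, ∑ i, ‖ProjectionScheme.gradV (V (m + 1)) i‖ ^ 2 with hN
    have h1 : ∑ m ∈ Finset.range M, ((∑ i, ‖ProjectionScheme.gradV (V (m + 1)) i‖ ^ 2)
        + ∑ i, ‖ProjectionScheme.gradH1 (W (m + 1 - 1) i)‖ ^ 2) ≤ (3 + 6 * c) * N := by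
      rw [hN, Finset.mul_sum]
      refine Finset.sum_le_sum fun m hm => ?_
      have := (hW m (Finset.mem_range.1 hm)).2
      rw [Nat.add_sub_cancel]
      linarith
    have h2 : k * N ≤ K := by
      linarith [hE M le_rfl, sq_nonneg ‖u M‖, sq_nonneg ‖k • ProjectionScheme.gradH1 (p M)‖]
    have h3 := mul_le_mul_of_nonneg_left h1 hk0.le
    have h4 := mul_le_mul_of_nonneg_left h2 (by positivity : 0 ≤ 3 + 6 * c)
    linarith
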